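/- Let $\mathcal L$ be a countable signature extending the language $\mathcal L_{\mathrm{PA}}=\{0,S,+,\times\}$ of Peano arithmetic, and let $M$ be a countable $\mathcal L$-structure such that: - $M$ satisfies $\mathrm{PA}$ (with induction for $\mathcal L_{\mathrm{PA}}$-formulas); - $M$ satisfies the full collection scheme: for every $\mathcal L$-formula $\phi(x,y)$ with parameters from $M$ and every $a\in M$, if for every $x<a$ there is $y$ with $M\models\phi(x,y)$, then there is $b\in M$ such that for every $x<a$ there is $y<b$ with $M\models\phi(x,y)$; - $M$ is piecewise recursively saturated: every recursive set $p(v)$ of $\mathcal L$-formulas with finitely many parameters from $M$ in which only finitely many symbols of $\mathcal L$ occur, and which is finitely satisfiable in $M$, is realised in $M$. Then there is a proper $\mathcal L$-elementary extension $M'\succ M$ which is an end-extension (that is, $a<c$ for all $a\in M$ and $c\in M'\setminus M$), such that $M$ is a locally semiregular cut of $M'$: $M$ is an initial segment of $M'$ closed under $S$ and containing a nonstandard element, and for every nonstandard $a\in M$ and every function $f:[0,a]\to M'$ coded in $M'$ there exist a nonstandard $a'\le a$ and $b\in M$ with $$f[[0,a']]\cap M\subseteq[0,b].$$ -/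

import Mathlib

open scoped FirstOrder

universe u v w

namespace Arith

/-- Function symbols of the language of Peano arithmetic: `0`, `S`, `+`, `×`. -/
inductive LPAFunc : ℕ → Type
  | zero : LPAFunc 0
  | succ : LPAFunc 1
  | add : LPAFunc 2
  | mul : LPAFunc 2

/-- The language of Peano arithmetic. -/
def LPA : FirstOrder.Language.{0, 0} := ⟨LPAFunc, fun _ => Empty⟩

section Arithmetic

variable {M : Type*} [LPA.Structure M]

/-- The interpretation of `0`. -/
def zero : M :=
  FirstOrder.Language.Structure.funMap (L := LPA) (M := M) LPAFunc.zero ![]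

/-- The interpretation of the successor function. -/
def succ (x : M) : M :=
  FirstOrder.Language.Structure.funMap (L := LPA) (M := M) LPAFunc.succ ![x]

/-- The interpretation of addition. -/
def add (x y : M) : M :=
  FirstOrder.Language.Structure.funMap (L := LPA) (M := M) LPAFunc.add ![x, y]

/-- The interpretation of multiplication. -/
def mul (x y : M) : M :=
  FirstOrder.Language.Structure.funMap (L := LPA) (M := M) LPAFunc.mul ![x, y]

/-- The usual arithmetical definition of `x ≤ y`. -/
def Le (x y : M) : Prop := ∃ z : M, add x z = y

/-- The usual arithmetical definition of `x < y`. -/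
def Lt (x y : M) : Prop := ∃ z : M, add x (succ z) = y

/-- `x` is standard: it is the value of a numeral `S ⋯ S 0`. -/
def IsStandard (x : M) : Prop := ∃ n : ℕ, succ^[n] (zero : M) = x

/-- `I` is a cut: an initial segment closed under successor. -/
def IsCut (I : Set M) : Prop :=
  (∀ a ∈ I, ∀ b : M, Le b a → b ∈ I) ∧ ∀ a ∈ I, succ a ∈ I

/-- The function `f : [0,a] → M` is coded in `M` (by Gödel's `β`-function): there are `c, d ∈ M`
such that `f x` is the remainder of `c` modulo `1 + (x + 1) d` for all `x ≤ a`. -/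
def IsCoded {a : M} (f : {x : M // Le x a} → M) : Prop :=
  ∃ c d : M, ∀ x : {x : M // Le x a},
    Lt (f x) (succ (mul (succ x.1) d)) ∧
      ∃ q : M, c = add (mul q (succ (mul (succ x.1) d))) (f x)

/-- `I` is a locally semiregular cut of `M`: it is a nonstandard cut, and every coded function
`f : [0,a] → M` with `a ∈ I` nonstandard can be restricted to `[0,a']` with `a'` nonstandard so
that those of its values that lie in `I` are bounded in `I`. -/
def IsLocallySemiregular (I : Set M) : Prop :=
  IsCut I ∧ (∃ a ∈ I, ¬ IsStandard a) ∧
    ∀ a ∈ I, ¬ IsStandard a → ∀ f : {x : M // Le x a} → M, IsCoded f →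
      ∃ a' : M, Le a' a ∧ ¬ IsStandard a' ∧
        ∃ b ∈ I, ∀ x : {x : M // Le x a}, Le x.1 a' → f x ∈ I → Le (f x) b

end Arithmetic

/-- `M` is a model of Peano arithmetic. In the induction scheme, variable `0` of `φ` is the
induction variable and the other ones are parameters. -/
structure IsModelPA (M : Type*) [LPA.Structure M] : Prop where
  succ_ne_zero : ∀ x : M, succ x ≠ zero
  succ_inj : ∀ x y : M, succ x = succ y → x = y
  add_zero : ∀ x : M, add x zero = x
  add_succ : ∀ x y : M, add x (succ y) = succ (add x y)
  mul_zero : ∀ x : M, mul x zero = zero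
  mul_succ : ∀ x y : M, mul x (succ y) = add (mul x y) x
  induction : ∀ (m : ℕ) (φ : LPA.Formula (Fin (m + 1))) (p : Fin m → M),
    φ.Realize (Fin.cons zero p : Fin (m + 1) → M) →
    (∀ x : M, φ.Realize (Fin.cons x p : Fin (m + 1) → M) →
      φ.Realize (Fin.cons (succ x) p : Fin (m + 1) → M)) →
    ∀ x : M, φ.Realize (Fin.cons x p : Fin (m + 1) → M)

/-- `M` satisfies the collection scheme for all `L`-formulas `φ(x, y, p)` with parameters `p`. -/
def SatisfiesCollection (L : FirstOrder.Language) (M : Type*) [LPA.Structure M] [L.Structure M] : Prop :=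
  ∀ (m : ℕ) (φ : L.Formula (Fin (m + 2))) (p : Fin m → M) (a : M),
    (∀ x : M, Lt x a → ∃ y : M,
      φ.Realize (Fin.cons x (Fin.cons y p : Fin (m + 1) → M) : Fin (m + 2) → M)) →
    ∃ b : M, ∀ x : M, Lt x a → ∃ y : M, Lt y b ∧
      φ.Realize (Fin.cons x (Fin.cons y p : Fin (m + 1) → M) : Fin (m + 2) → M)

section Recursive

variable {L : FirstOrder.Language}

/-- The symbols of `L` that occur in a term. -/
def termSymbols {α : Type*} : L.Term α → Set L.Symbols
  | .var _ => ∅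
  | .func f ts => {Sum.inl ⟨_, f⟩} ∪ ⋃ i, termSymbols (ts i)

/-- The symbols of `L` that occur in a formula. -/
def formulaSymbols {α : Type*} : {n : ℕ} → L.BoundedFormula α n → Set L.Symbols
  | _, .falsum => ∅
  | _, .equal t₁ t₂ => termSymbols t₁ ∪ termSymbols t₂
  | _, .rel R ts => {Sum.inr ⟨_, R⟩} ∪ ⋃ i, termSymbols (ts i)
  | _, .imp φ ψ => formulaSymbols φ ∪ formulaSymbols ψ
  | _, .all φ => formulaSymbols φ

/-- The Gödel number of a term, given a numbering `e` of the symbols. -/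
def termCode (e : L.Symbols → ℕ) {k n : ℕ} : L.Term (Fin k ⊕ Fin n) → ℕ
  | .var (.inl i) => Nat.pair 0 i
  | .var (.inr i) => Nat.pair 1 i
  | .func f ts =>
      Nat.pair 2 (Nat.pair (e (Sum.inl ⟨_, f⟩))
        (Encodable.encode (List.ofFn fun i => termCode e (ts i))))

/-- The Gödel number of a formula, given a numbering `e` of the symbols. -/
def formulaCode (e : L.Symbols → ℕ) {k : ℕ} : {n : ℕ} → L.BoundedFormula (Fin k) n → ℕ
  | _, .falsum => Nat.pair 0 0
  | _, .equal t₁ t₂ => Nat.pair 1 (Nat.pair (termCode e t₁) (termCode e t₂))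
  | _, .rel R ts =>
      Nat.pair 2 (Nat.pair (e (Sum.inr ⟨_, R⟩))
        (Encodable.encode (List.ofFn fun i => termCode e (ts i))))
  | _, .imp φ ψ => Nat.pair 3 (Nat.pair (formulaCode e φ) (formulaCode e ψ))
  | _, .all φ => Nat.pair 4 (formulaCode e φ)

/-- `p` is a recursive set of formulas in which only finitely many symbols of `L` occur. For such
`p` recursiveness does not depend on the numbering of the symbols that occur. -/
def IsFiniteSymbolRecursive {k : ℕ} (p : Set (L.Formula (Fin k))) : Prop :=
  (⋃ φ ∈ p, formulaSymbols φ).Finite ∧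
    ∃ e : L.Symbols → ℕ, Set.InjOn e (⋃ φ ∈ p, formulaSymbols φ) ∧
      ComputablePred fun c : ℕ => ∃ φ ∈ p, formulaCode e φ = c

/-- `M` is piecewise recursively saturated: every recursive type `p(v, a)` over `M`, with finitely
many parameters `a` and finitely many symbols, is realised in `M`. Variable `0` of the formulas
is `v`. -/
def IsPiecewiseRecursivelySaturated (L : FirstOrder.Language) (M : Type*) [L.Structure M] : Prop :=
  ∀ (m : ℕ) (p : Set (L.Formula (Fin (m + 1)))) (a : Fin m → M),
    IsFiniteSymbolRecursive p →
    (∀ F : Finset (L.Formula (Fin (m + 1))), ↑F ⊆ p →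
      ∃ x : M, ∀ φ ∈ F, φ.Realize (Fin.cons x a : Fin (m + 1) → M)) →
    ∃ x : M, ∀ φ ∈ p, φ.Realize (Fin.cons x a : Fin (m + 1) → M)

end Recursive

/-- The embedding `j : M → N` makes `N` a proper end-extension of `M`. -/
def IsProperEndExtension {M N : Type*} [LPA.Structure N] (j : M → N) : Prop :=
  Set.range j ≠ Set.univ ∧ ∀ c : N, c ∉ Set.range j → ∀ a : M, Lt (j a) c

end Arith

/-! The extension is a definable ultrapower of `M` built by forcing. A condition is a definable
decreasing family of nonempty sets `D_u` (`u ∈ M`) of assignments `ℕ → M`; a stronger condition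
shrinks each `D_u`. By countability there is a filter of conditions meeting all the dense sets
needed. All the sets `D_u` of its members have the finite intersection property, so they lie in some
ultrafilter `U`. The extension `N` consists of the classes in the ultrapower of `M` modulo `U` of
the coordinate functions `s ↦ s j`.

Density arguments give the properties of `N`. Fresh coordinates can be made Skolem witnesses
(`exists_formula_witness`), so `N` passes the Tarski–Vaught test, or constants (`exists_const`), so
`M` embeds elementarily. Starting from `u < s 0` makes the extension proper. Collection
(`exists_decide_lt`) shows that a coordinate which cannot be kept equal to any fixed `m ≤ a` exceeds
`a` on some `D_u`, whence an end-extension.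

For local semiregularity, consider the function coded by two coordinates. For finitely many
arguments one can decide in turn whether the value stays below a fixed bound or eventually passes
every `u` (`exists_standard_bound`). So for each standard `n` some `b` makes every value at an
argument up to `n` either at most `b` or above `u` on a shrunken family. That is a definable
property of `n`, and saturation supplies the overspill (`exists_nonstandard`) that carries it to a
nonstandard `a'`; induction for formulas of the larger language is not available. In `N`, a value
above every `u ∈ M` lies outside `M`, so the values in `M` are bounded by `b`. -/

namespace Arith

/-! ### Relations definable with parameters. -/

section ParamDefinable

open FirstOrder Language

variable {K : FirstOrder.Language.{u, v}} {M : Type w} [K.Structure M] {α β : Type*}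

/-- Whether a formula holds depends only on finitely many of its variables. -/
theorem exists_finset_support {γ : Type*} (φ : K.Formula γ) :
    ∃ S : Finset γ, ∀ v v' : γ → M, (∀ i ∈ S, v i = v' i) → (φ.Realize v ↔ φ.Realize v') := by
  classical
  refine ⟨φ.freeVarFinset, fun v v' h => ?_⟩
  rw [Formula.Realize, ← BoundedFormula.realize_restrictFreeVar
    (f := (id : φ.freeVarFinset → φ.freeVarFinset)) (v := fun i => v i) v (fun _ => rfl),
    Formula.Realize, ← BoundedFormula.realize_restrictFreeVar
    (f := (id : φ.freeVarFinset → φ.freeVarFinset)) (v := fun i => v' i) v' (fun _ => rfl)]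
  exact iff_of_eq (congrArg (fun w => BoundedFormula.Realize _ w default)
    (funext fun i => h i i.2))

variable (K) in
/-- The relation `P` is definable with parameters. -/
def ParamDef (P : (α → M) → Prop) : Prop :=
  ∃ φ : K.Formula (α ⊕ M), ∀ v, φ.Realize (Sum.elim v id) ↔ P v

variable (K) in
/-- The function `f` is given by a term with parameters. -/
def ParamTerm (f : (α → M) → M) : Prop :=
  ∃ t : K.Term (α ⊕ M), ∀ v, t.realize (Sum.elim v id) = f v

theorem ParamTerm.var (i : α) : ParamTerm K (fun v : α → M => v i) :=
  ⟨.var (.inl i), fun _ => rfl⟩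

theorem ParamTerm.const (m : M) : ParamTerm K (fun _ : α → M => m) :=
  ⟨.var (.inr m), fun _ => rfl⟩

theorem ParamDef.eq {f g : (α → M) → M} (hf : ParamTerm K f) (hg : ParamTerm K g) :
    ParamDef K (fun v => f v = g v) := by
  obtain ⟨t, ht⟩ := hf
  obtain ⟨t', ht'⟩ := hg
  exact ⟨t.equal t', fun v => by simp [ht, ht']⟩

theorem ParamDef.not {P : (α → M) → Prop} (h : ParamDef K P) : ParamDef K (fun v => ¬ P v) := by
  obtain ⟨φ, hφ⟩ := h
  exact ⟨φ.not, fun v => by simp [Formula.realize_not, hφ]⟩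

theorem ParamDef.imp {P Q : (α → M) → Prop} (h : ParamDef K P) (h' : ParamDef K Q) :
    ParamDef K (fun v => P v → Q v) := by
  obtain ⟨φ, hφ⟩ := h
  obtain ⟨ψ, hψ⟩ := h'
  exact ⟨φ.imp ψ, fun v => by simp [Formula.realize_imp, hφ, hψ]⟩

theorem ParamDef.congr {P Q : (α → M) → Prop} (h : ParamDef K P) (hPQ : ∀ v, P v ↔ Q v) :
    ParamDef K Q := by
  rwa [show Q = P from funext fun v => propext (hPQ v).symm]

theorem ParamDef.and {P Q : (α → M) → Prop} (h : ParamDef K P) (h' : ParamDef K Q) :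
    ParamDef K (fun v => P v ∧ Q v) :=
  (h.imp h'.not).not.congr fun v => by tauto

theorem ParamDef.or {P Q : (α → M) → Prop} (h : ParamDef K P) (h' : ParamDef K Q) :
    ParamDef K (fun v => P v ∨ Q v) :=
  (h.not.imp h').congr fun v => by tauto

/-- Substitution of terms into a definable relation. -/
theorem ParamDef.subst {P : (β → M) → Prop} (h : ParamDef K P) {f : β → (α → M) → M}
    (hf : ∀ i, ParamTerm K (f i)) : ParamDef K (fun v => P fun i => f i v) := by
  obtain ⟨φ, hφ⟩ := h
  choose t ht using hf
  refine ⟨BoundedFormula.subst φ (Sum.elim t fun m => .var (.inr m)), fun v => ?_⟩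
  refine Iff.trans ?_ (hφ _)
  rw [Formula.Realize, BoundedFormula.realize_subst, Formula.Realize]
  refine iff_of_eq (congrArg (fun w => BoundedFormula.Realize φ w default) (funext fun i => ?_))
  cases i <;> simp [ht]

/-- Quantification over a possibly infinite block of variables. -/
theorem ParamDef.exs [Nonempty M] {P : (α → M) → (β → M) → Prop}
    (h : ParamDef K (fun w : α ⊕ β → M => P (fun i => w (.inl i)) (fun i => w (.inr i)))) :
    ParamDef K (fun v => ∃ s, P v s) := by
  classical
  obtain ⟨φ, hφ⟩ := h
  obtain ⟨S, hS⟩ := exists_finset_support (M := M) φ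
  obtain ⟨m₀⟩ := ‹Nonempty M›
  -- Only the variables of the block that occur in `φ` are quantified; the others are replaced by
  -- the parameter `m₀`.
  let T : Finset β := S.preimage (fun b => Sum.inl (Sum.inr b)) (by intro; simp)
  let g : (α ⊕ β) ⊕ M → (α ⊕ M) ⊕ T :=
    Sum.elim (Sum.elim (fun a => .inl (.inl a))
      (fun b => if hb : b ∈ T then .inr ⟨b, hb⟩ else .inl (.inr m₀))) (fun m => .inl (.inr m))
  have key : ∀ (v : α → M) (s : β → M), φ.Realize (Sum.elim (Sum.elim v s) id) ↔ P v s :=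
    fun v s => by simpa using hφ (Sum.elim v s)
  refine ⟨(φ.relabel g).iExs T, fun v => ?_⟩
  rw [Formula.realize_iExs]
  simp only [Formula.realize_relabel]
  constructor
  · rintro ⟨i, hi⟩
    refine ⟨fun b => if hb : b ∈ T then i ⟨b, hb⟩ else m₀, (key _ _).1 ?_⟩
    convert hi using 1
    funext x
    rcases x with (a | b) | m
    · rfl
    · by_cases hb : b ∈ T <;> simp [g, hb]
    · rfl
  · rintro ⟨s, hs⟩
    refine ⟨fun b => s b, (hS _ _ ?_).1 ((key _ _).2 hs)⟩
    rintro ((a | b) | m) hx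
    · rfl
    · have hb : b ∈ T := Finset.mem_preimage.2 hx
      simp [g, hb]
    · rfl

theorem ParamDef.ex [Nonempty M] {P : (α → M) → M → Prop}
    (h : ParamDef K (fun w : α ⊕ Unit → M => P (fun i => w (.inl i)) (w (.inr ())))) :
    ParamDef K (fun v => ∃ y, P v y) :=
  (ParamDef.exs (P := fun v (s : Unit → M) => P v (s ())) h).congr fun _ =>
    ⟨fun ⟨s, hs⟩ => ⟨s (), hs⟩, fun ⟨y, hy⟩ => ⟨fun _ => y, hy⟩⟩

theorem ParamDef.all [Nonempty M] {P : (α → M) → M → Prop}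
    (h : ParamDef K (fun w : α ⊕ Unit → M => P (fun i => w (.inl i)) (w (.inr ())))) :
    ParamDef K (fun v => ∀ y, P v y) :=
  (ParamDef.ex (P := fun v y => ¬ P v y) h.not).not.congr fun _ => by simp

/-- A definable relation depends on finitely many of the variables. -/
theorem ParamDef.exists_support {P : (ℕ → M) → Prop} (h : ParamDef K P) :
    ∃ n : ℕ, ∀ v v' : ℕ → M, (∀ i < n, v i = v' i) → (P v ↔ P v') := by
  obtain ⟨φ, hφ⟩ := h
  obtain ⟨S, hS⟩ := exists_finset_support (M := M) φ
  let T : Finset ℕ := S.preimage Sum.inl (by intro; simp)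
  refine ⟨T.sup id + 1, fun v v' hv => ?_⟩
  rw [← hφ, ← hφ]
  refine hS _ _ ?_
  rintro (i | m) hi
  · have : i ∈ T := Finset.mem_preimage.2 hi
    exact hv i (Nat.lt_succ_of_le (Finset.le_sup (f := id) this))
  · rfl

/-- A relation that is definable with parameters is definable with a finite list of parameters. -/
theorem ParamDef.exists_formula [Nonempty M] {P : (α → M) → Prop} (h : ParamDef K P) :
    ∃ (m : ℕ) (φ : K.Formula (α ⊕ Fin m)) (p : Fin m → M),
      ∀ v, φ.Realize (Sum.elim v p) ↔ P v := by
  classical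
  obtain ⟨φ, hφ⟩ := h
  obtain ⟨S, hS⟩ := exists_finset_support (M := M) φ
  obtain ⟨m₀⟩ := ‹Nonempty M›
  -- Inserting `m₀` keeps the parameter list nonempty, as `Function.invFun` requires.
  let T : Finset M := insert m₀ (S.preimage Sum.inr (by intro; simp))
  let p : Fin T.card → M := fun i => T.equivFin.symm i
  have hp : ∀ m ∈ T, m ∈ Set.range p := fun m hm => ⟨T.equivFin ⟨m, hm⟩, by simp [p]⟩
  have : Nonempty (Fin T.card) := ⟨(hp m₀ (by simp [T])).choose⟩
  refine ⟨T.card, φ.relabel (Sum.map id (Function.invFun p)), p, fun v => ?_⟩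
  rw [Formula.realize_relabel, ← hφ]
  refine hS _ _ ?_
  rintro (a | m) hx
  · rfl
  · exact Function.invFun_eq (hp m (by simp [T, hx]))

theorem ParamDef.exists_formula_one [Nonempty M] {P : M → Prop}
    (h : ParamDef K (fun v : Fin 1 → M => P (v 0))) :
    ∃ (m : ℕ) (φ : K.Formula (Fin (m + 1))) (p : Fin m → M),
      ∀ x, φ.Realize (Fin.cons x p : Fin (m + 1) → M) ↔ P x := by
  obtain ⟨m, φ, p, hφ⟩ := h.exists_formula
  refine ⟨m, φ.relabel (Sum.elim (fun _ => 0) Fin.succ), p, fun x => ?_⟩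
  rw [Formula.realize_relabel, ← hφ fun _ => x]
  refine iff_of_eq (congrArg φ.Realize (funext fun i => ?_))
  cases i <;> simp

theorem ParamDef.exists_formula_two [Nonempty M] {P : M → M → Prop}
    (h : ParamDef K (fun v : Fin 2 → M => P (v 0) (v 1))) :
    ∃ (m : ℕ) (φ : K.Formula (Fin (m + 2))) (p : Fin m → M),
      ∀ x y, φ.Realize (Fin.cons x (Fin.cons y p : Fin (m + 1) → M) : Fin (m + 2) → M) ↔
        P x y := by
  obtain ⟨m, φ, p, hφ⟩ := h.exists_formula
  refine ⟨m, φ.relabel (Sum.elim ![0, 1] fun i => i.succ.succ), p, fun x y => ?_⟩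
  refine Formula.realize_relabel.trans (Iff.trans ?_ (hφ ![x, y]))
  refine iff_of_eq (congrArg φ.Realize (funext fun i => ?_))
  rcases i with i | i
  · fin_cases i <;> rfl
  · simp

end ParamDefinable

/-! ### Definability of the order and of Gödel's β-function. -/

section Definability

open FirstOrder Language

variable {L : FirstOrder.Language.{u, v}} {M : Type w} [LPA.Structure M] [L.Structure M]
  {α : Type*}

instance nonempty_of_structure : Nonempty M := ⟨zero⟩

theorem ParamTerm.zero : ParamTerm LPA (fun _ : α → M => (Arith.zero : M)) :=
  .const _

/-- The term `S t`. -/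
def succTerm (t : LPA.Term α) : LPA.Term α := .func LPAFunc.succ ![t]

/-- The term `t + t'`. -/
def addTerm (t t' : LPA.Term α) : LPA.Term α := .func LPAFunc.add ![t, t']

/-- The term `t × t'`. -/
def mulTerm (t t' : LPA.Term α) : LPA.Term α := .func LPAFunc.mul ![t, t']

@[simp]
theorem realize_succTerm (t : LPA.Term α) (v : α → M) :
    (succTerm t).realize v = Arith.succ (t.realize v) :=
  congrArg (Structure.funMap (L := LPA) (M := M) LPAFunc.succ)
    (funext fun i => by fin_cases i; rfl)

@[simp]
theorem realize_addTerm (t t' : LPA.Term α) (v : α → M) :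
    (addTerm t t').realize v = Arith.add (t.realize v) (t'.realize v) :=
  congrArg (Structure.funMap (L := LPA) (M := M) LPAFunc.add)
    (funext fun i => by fin_cases i <;> rfl)

@[simp]
theorem realize_mulTerm (t t' : LPA.Term α) (v : α → M) :
    (mulTerm t t').realize v = Arith.mul (t.realize v) (t'.realize v) :=
  congrArg (Structure.funMap (L := LPA) (M := M) LPAFunc.mul)
    (funext fun i => by fin_cases i <;> rfl)

theorem ParamTerm.succ {f : (α → M) → M} (hf : ParamTerm LPA f) :
    ParamTerm LPA (fun v => Arith.succ (f v)) := by
  obtain ⟨t, ht⟩ := hf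
  exact ⟨succTerm t, fun v => by simp [ht]⟩

theorem ParamTerm.add {f g : (α → M) → M} (hf : ParamTerm LPA f) (hg : ParamTerm LPA g) :
    ParamTerm LPA (fun v => Arith.add (f v) (g v)) := by
  obtain ⟨t, ht⟩ := hf
  obtain ⟨t', ht'⟩ := hg
  exact ⟨addTerm t t', fun v => by simp [ht, ht']⟩

theorem ParamTerm.mul {f g : (α → M) → M} (hf : ParamTerm LPA f) (hg : ParamTerm LPA g) :
    ParamTerm LPA (fun v => Arith.mul (f v) (g v)) := by
  obtain ⟨t, ht⟩ := hf
  obtain ⟨t', ht'⟩ := hg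
  exact ⟨mulTerm t t', fun v => by simp [ht, ht']⟩

/-- Arithmetically definable relations are definable in the larger language. -/
theorem ParamDef.sum {P : (α → M) → Prop} (h : ParamDef LPA P) : ParamDef (LPA.sum L) P := by
  obtain ⟨φ, hφ⟩ := h
  exact ⟨LHom.sumInl.onFormula φ, fun v => by rw [LHom.realize_onFormula, hφ]⟩

/-- `y` is the value at `x` of the function with `β`-code `(c, d)`. -/
def Beta (c d x y : M) : Prop :=
  Lt y (succ (mul (succ x) d)) ∧ ∃ q : M, c = add (mul q (succ (mul (succ x) d))) y

theorem ParamDef.ltArith {f g : (α → M) → M} (hf : ParamTerm LPA f) (hg : ParamTerm LPA g) :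
    ParamDef LPA (fun v => Lt (f v) (g v)) :=
  (ParamDef.ex (P := fun (v : Fin 2 → M) z => Arith.add (v 0) (Arith.succ z) = v 1)
    (.eq (.add (.var _) (.succ (.var _))) (.var _))).subst
    (f := ![f, g]) (by intro i; fin_cases i <;> assumption)

theorem ParamDef.lt {f g : (α → M) → M} (hf : ParamTerm (LPA.sum L) f)
    (hg : ParamTerm (LPA.sum L) g) : ParamDef (LPA.sum L) (fun v => Lt (f v) (g v)) :=
  (ParamDef.sum (L := L) (ParamDef.ltArith (M := M) (.var (0 : Fin 2)) (.var 1))).subst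
    (f := ![f, g]) (by intro i; fin_cases i <;> assumption)

theorem ParamDef.le {f g : (α → M) → M} (hf : ParamTerm (LPA.sum L) f)
    (hg : ParamTerm (LPA.sum L) g) : ParamDef (LPA.sum L) (fun v => Le (f v) (g v)) :=
  (ParamDef.sum (L := L) (ParamDef.ex
    (P := fun (v : Fin 2 → M) z => Arith.add (v 0) z = v 1)
    (.eq (.add (.var _) (.var _)) (.var _)))).subst
    (f := ![f, g]) (by intro i; fin_cases i <;> assumption)

theorem ParamDef.beta {c d x y : (α → M) → M} (hc : ParamTerm (LPA.sum L) c)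
    (hd : ParamTerm (LPA.sum L) d) (hx : ParamTerm (LPA.sum L) x) (hy : ParamTerm (LPA.sum L) y) :
    ParamDef (LPA.sum L) (fun v => Beta (c v) (d v) (x v) (y v)) := by
  have h : ParamDef LPA fun v : Fin 4 → M => Beta (v 0) (v 1) (v 2) (v 3) := by
    refine .and (.ltArith (.var 3) (.succ (.mul (.succ (.var 2)) (.var 1)))) (.ex ?_)
    exact .eq (.var _) (.add (.mul (.var _) (.succ (.mul (.succ (.var _)) (.var _)))) (.var _))
  exact (h.sum (L := L)).subst (f := ![c, d, x, y]) (by intro i; fin_cases i <;> assumption)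

end Definability

/-! ### Elementary arithmetic in models of PA. -/

namespace IsModelPA

variable {M : Type w} [LPA.Structure M] (hM : IsModelPA M)

include hM

theorem ind {P : M → Prop} (hP : ParamDef LPA (fun v : Fin 1 → M => P (v 0)))
    (h0 : P zero) (hs : ∀ x, P x → P (succ x)) (x : M) : P x := by
  obtain ⟨m, φ, p, hφ⟩ := hP.exists_formula_one
  exact (hφ x).1 (hM.induction m φ p ((hφ _).2 h0) (fun y hy => (hφ _).2 (hs y ((hφ y).1 hy))) x)

theorem zero_add (x : M) : add zero x = x := by
  refine hM.ind (P := fun x => add zero x = x) (.eq (.add .zero (.var 0)) (.var 0))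
    (hM.add_zero _) (fun x hx => ?_) x
  rw [hM.add_succ, hx]

theorem succ_add (x y : M) : add (succ x) y = succ (add x y) := by
  refine hM.ind (P := fun y => add (succ x) y = succ (add x y))
    (.eq (.add (.const _) (.var 0)) (.succ (.add (.const _) (.var 0)))) ?_ (fun y hy => ?_) y
  · rw [hM.add_zero, hM.add_zero]
  · rw [hM.add_succ, hy, hM.add_succ]

theorem add_comm (x y : M) : add x y = add y x := by
  refine hM.ind (P := fun y => add x y = add y x)
    (.eq (.add (.const _) (.var 0)) (.add (.var 0) (.const _))) ?_ (fun y hy => ?_) y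
  · rw [hM.add_zero, hM.zero_add]
  · rw [hM.add_succ, hy, hM.succ_add]

theorem add_assoc (x y z : M) : add (add x y) z = add x (add y z) := by
  refine hM.ind (P := fun z => add (add x y) z = add x (add y z))
    (.eq (.add (.const _) (.var 0)) (.add (.const _) (.add (.const _) (.var 0)))) ?_
    (fun z hz => ?_) z
  · rw [hM.add_zero, hM.add_zero]
  · rw [hM.add_succ, hz, hM.add_succ, hM.add_succ]

theorem add_right_cancel {x y z : M} : add x z = add y z → x = y := by
  refine hM.ind (P := fun z => add x z = add y z → x = y)
    (.imp (.eq (.add (.const _) (.var 0)) (.add (.const _) (.var 0)))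
      (.eq (.const _) (.const _))) ?_ (fun z hz h => ?_) z
  · rw [hM.add_zero, hM.add_zero]
    exact id
  · rw [hM.add_succ, hM.add_succ] at h
    exact hz (hM.succ_inj _ _ h)

theorem add_left_cancel {x y z : M} (h : add z x = add z y) : x = y := by
  rw [hM.add_comm z, hM.add_comm z] at h
  exact hM.add_right_cancel h

theorem add_mul (x y t : M) : mul (add x y) t = add (mul x t) (mul y t) := by
  refine hM.ind (P := fun t => mul (add x y) t = add (mul x t) (mul y t))
    (.eq (.mul (.const _) (.var 0)) (.add (.mul (.const _) (.var 0)) (.mul (.const _) (.var 0))))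
    ?_ (fun t ht => ?_) t
  · rw [hM.mul_zero, hM.mul_zero, hM.mul_zero, hM.add_zero]
  · rw [hM.mul_succ, hM.mul_succ, hM.mul_succ, ht, hM.add_assoc, hM.add_assoc,
      ← hM.add_assoc (mul y t), hM.add_comm (mul y t) x, hM.add_assoc x]

theorem eq_zero_or_succ (x : M) : x = zero ∨ ∃ y, x = succ y := by
  refine hM.ind (P := fun x => x = zero ∨ ∃ y, x = succ y)
    (.or (.eq (.var 0) .zero) (.ex (.eq (.var _) (.succ (.var _))))) (.inl rfl)
    (fun x _ => .inr ⟨x, rfl⟩) x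

theorem le_refl (x : M) : Le x x := ⟨zero, hM.add_zero x⟩

theorem lt_irrefl (x : M) : ¬ Lt x x := fun ⟨z, hz⟩ =>
  hM.succ_ne_zero z (hM.add_left_cancel (z := x) (hz.trans (hM.add_zero x).symm))

theorem le_trans {x y z : M} : Le x y → Le y z → Le x z := by
  rintro ⟨a, rfl⟩ ⟨b, rfl⟩
  exact ⟨add a b, (hM.add_assoc _ _ _).symm⟩

theorem lt_of_lt_of_le {x y z : M} : Lt x y → Le y z → Lt x z := by
  rintro ⟨a, rfl⟩ ⟨b, rfl⟩
  exact ⟨add a b, by rw [hM.add_assoc, hM.succ_add]⟩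

theorem lt_of_le_of_lt {x y z : M} : Le x y → Lt y z → Lt x z := by
  rintro ⟨a, rfl⟩ ⟨b, rfl⟩
  exact ⟨add a b, by rw [hM.add_assoc, hM.add_succ, hM.add_succ, hM.add_succ]⟩

omit hM in
theorem le_of_lt {x y : M} : Lt x y → Le x y := fun ⟨z, hz⟩ => ⟨succ z, hz⟩

theorem lt_succ_iff {x y : M} : Lt x (succ y) ↔ Le x y := by
  constructor
  · rintro ⟨z, hz⟩
    exact ⟨z, hM.succ_inj _ _ ((hM.add_succ x z).symm.trans hz)⟩
  · rintro ⟨z, rfl⟩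
    exact ⟨z, hM.add_succ x z⟩

theorem le_or_lt (x y : M) : Le x y ∨ Lt y x := by
  have hdef : ParamDef LPA (fun v : Fin 1 → M => Le (v 0) y ∨ Lt y (v 0)) :=
    .or (.ex (.eq (.add (.var _) (.var _)) (.const _))) (.ltArith (.const _) (.var 0))
  refine hM.ind (P := fun x => Le x y ∨ Lt y x) hdef (.inl ⟨y, hM.zero_add y⟩) (fun x hx => ?_) x
  rcases hx with ⟨z, rfl⟩ | h
  · rcases hM.eq_zero_or_succ z with rfl | ⟨z, rfl⟩
    · exact .inr (hM.lt_succ_iff.2 (by rw [hM.add_zero]; exact hM.le_refl x))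
    · exact .inl ⟨z, by rw [hM.succ_add, hM.add_succ]⟩
  · exact .inr (hM.lt_succ_iff.2 (le_of_lt h))

theorem exists_ge (x y : M) : ∃ z, Le x z ∧ Le y z := by
  rcases hM.le_or_lt x y with h | h
  · exact ⟨y, h, hM.le_refl y⟩
  · exact ⟨x, hM.le_refl x, le_of_lt h⟩

theorem exists_standard_of_le (n : ℕ) {x : M} (h : Le x (succ^[n] zero)) :
    ∃ k ≤ n, x = succ^[k] zero := by
  induction n with
  | zero =>
    obtain ⟨z, hz⟩ := h
    rcases hM.eq_zero_or_succ z with rfl | ⟨z, rfl⟩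
    · exact ⟨0, le_rfl, (hM.add_zero x).symm.trans hz⟩
    · rw [hM.add_succ] at hz
      exact absurd hz (hM.succ_ne_zero _)
  | succ n ih =>
    obtain ⟨z, hz⟩ := h
    rcases hM.eq_zero_or_succ z with rfl | ⟨z, rfl⟩
    · exact ⟨n + 1, le_rfl, (hM.add_zero x).symm.trans hz⟩
    · rw [hM.add_succ, Function.iterate_succ_apply'] at hz
      obtain ⟨k, hk, rfl⟩ := ih ⟨z, hM.succ_inj _ _ hz⟩
      exact ⟨k, hk.trans n.le_succ, rfl⟩

theorem standard_injective : Function.Injective fun n : ℕ => succ^[n] (zero : M) := by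
  intro n
  induction n with
  | zero =>
    rintro (_ | m) h
    · rfl
    · simp only [Function.iterate_succ_apply'] at h
      exact absurd h.symm (hM.succ_ne_zero _)
  | succ n ih =>
    rintro (_ | m) h
    · simp only [Function.iterate_succ_apply'] at h
      exact absurd h (hM.succ_ne_zero _)
    · simp only [Function.iterate_succ_apply'] at h
      rw [ih (hM.succ_inj _ _ h)]

theorem standard_le {a : M} (ha : ¬ IsStandard a) (n : ℕ) : Le (succ^[n] zero) a := by
  rcases hM.le_or_lt (succ^[n] zero) a with h | h
  · exact h
  · obtain ⟨k, -, rfl⟩ := hM.exists_standard_of_le n (le_of_lt h)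
    exact absurd ⟨k, rfl⟩ ha

theorem remainder_unique_of_le {t q q' y y' : M} (hy : Lt y t) (hq : Le q q')
    (h : add (mul q t) y = add (mul q' t) y') : y = y' := by
  obtain ⟨k, rfl⟩ := hq
  rw [hM.add_mul, hM.add_assoc] at h
  have h := hM.add_left_cancel h
  rcases hM.eq_zero_or_succ k with rfl | ⟨k, rfl⟩
  · have h0 : mul zero t = zero :=
      hM.ind (P := fun t => mul zero t = zero) (.eq (.mul .zero (.var 0)) .zero) (hM.mul_zero _)
        (fun t ht => by rw [hM.mul_succ, ht, hM.add_zero]) t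
    rwa [h0, hM.zero_add] at h
  · have h1 : mul (succ k) t = add t (mul k t) := by
      have h1 : mul (succ zero) t = t :=
        hM.ind (P := fun t => mul (succ zero) t = t) (.eq (.mul (.const _) (.var 0)) (.var 0))
          (hM.mul_zero _) (fun t ht => by rw [hM.mul_succ, ht, hM.add_succ, hM.add_zero]) t
      rw [← hM.zero_add k, ← hM.succ_add, hM.add_mul, h1, hM.zero_add]
    -- Distinct quotients would give `y = t + ⋯`, against `y < t`.
    rw [h1, hM.add_assoc] at h
    exact absurd (hM.lt_of_lt_of_le hy ⟨_, h.symm⟩) (hM.lt_irrefl y)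

/-- Remainders are unique. In the forcing argument this turns "some β-value exceeds `u`" into "every
β-value exceeds `u`". -/
theorem beta_unique {c d x y y' : M} (h : Beta c d x y) (h' : Beta c d x y') : y = y' := by
  obtain ⟨hy, q, rfl⟩ := h
  obtain ⟨hy', q', h'⟩ := h'
  rcases hM.le_or_lt q q' with hq | hq
  · exact hM.remainder_unique_of_le hy hq h'
  · exact (hM.remainder_unique_of_le hy' (le_of_lt hq) h'.symm).symm

end IsModelPA

/-! ### Overspill from recursive saturation, and collection for definable relations. -/

section Saturation

open FirstOrder Language

theorem termSymbols_finite {L : FirstOrder.Language.{u, v}} {α : Type*} (t : L.Term α) :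
    (termSymbols t).Finite := by
  induction t with
  | var => exact Set.finite_empty
  | func f ts ih => exact (Set.finite_singleton _).union (Set.finite_iUnion ih)

theorem formulaSymbols_finite {L : FirstOrder.Language.{u, v}} {α : Type*} {n : ℕ}
    (φ : L.BoundedFormula α n) : (formulaSymbols φ).Finite := by
  induction φ with
  | falsum => exact Set.finite_empty
  | equal t₁ t₂ => exact (termSymbols_finite t₁).union (termSymbols_finite t₂)
  | rel R ts =>
    exact (Set.finite_singleton _).union (Set.finite_iUnion fun i => termSymbols_finite (ts i))
  | imp φ ψ ih ih' => exact ih.union ih'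
  | all φ ih => exact ih

variable {L : FirstOrder.Language.{u, v}} {M : Type w} [LPA.Structure M] [L.Structure M]

variable (L) in
/-- The function symbol `0` of a language extending that of arithmetic. -/
def zeroFunc : (LPA.sum L).Functions 0 := Sum.inl LPAFunc.zero

variable (L) in
/-- The function symbol `S` of a language extending that of arithmetic. -/
def succFunc : (LPA.sum L).Functions 1 := Sum.inl LPAFunc.succ

variable (L) in
/-- The numeral `S ⋯ S 0`. -/
def numeral (α : Type*) : ℕ → (LPA.sum L).Term α
  | 0 => .func (zeroFunc L) Fin.elim0
  | n + 1 => .func (succFunc L) fun _ => numeral α n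

theorem realize_numeral {α : Type*} (v : α → M) (n : ℕ) :
    (numeral L α n).realize v = succ^[n] zero := by
  induction n with
  | zero => exact congrArg (Structure.funMap (L := LPA) LPAFunc.zero) (Subsingleton.elim _ _)
  | succ n ih =>
    rw [Function.iterate_succ_apply', ← ih]
    exact congrArg (Structure.funMap (L := LPA) LPAFunc.succ)
      (funext fun i => by fin_cases i; rfl)

theorem termSymbols_numeral (α : Type*) (n : ℕ) :
    termSymbols (numeral L α n) ⊆ {Sum.inl ⟨0, zeroFunc L⟩, Sum.inl ⟨1, succFunc L⟩} := by
  induction n with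
  | zero =>
    rw [numeral, termSymbols]
    simp
  | succ n ih =>
    rw [numeral, termSymbols]
    simp only [Set.iUnion_const]
    exact Set.union_subset (by simp) ih

/-- Exhibits the code of a numeral as an iterate of one primitive recursive step; `Nat.pair x 0 + 1`
encodes the one-element list `[x]`. -/
theorem termCode_numeral (e : (LPA.sum L).Symbols → ℕ) (k n m : ℕ) :
    termCode e (numeral L (Fin k ⊕ Fin n) m) =
      (fun x => Nat.pair 2 (Nat.pair (e (Sum.inl ⟨1, succFunc L⟩)) (Nat.pair x 0 + 1)))^[m]
        (termCode e (numeral L (Fin k ⊕ Fin n) 0)) := by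
  induction m with
  | zero => rfl
  | succ m ih =>
    rw [Function.iterate_succ_apply', ← ih, numeral, termCode]
    simp

/-- The formula `v ≠ S ⋯ S 0`. -/
def neNumeral (L : FirstOrder.Language.{u, v}) (m n : ℕ) : (LPA.sum L).Formula (Fin (m + 1)) :=
  .imp (.equal (numeral L _ n) (.var (.inl 0))) .falsum

theorem realize_neNumeral (m n : ℕ) (v : Fin (m + 1) → M) :
    (neNumeral L m n).Realize v ↔ succ^[n] zero ≠ v 0 := by
  have : (neNumeral L m n).Realize v ↔
      ((numeral L _ n).realize (Sum.elim v default) = v 0 → False) := Iff.rfl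
  rw [this, realize_numeral]

/-- The code of `v ≠ n` is primitive recursive in `n` and at least `n`, so membership of `c` is
decided by a search over `n ≤ c`. The extra code `c₀` is for the one further formula of the
overspill type. -/
theorem computablePred_code_neNumeral (e : (LPA.sum L).Symbols → ℕ) (m c₀ : ℕ) :
    ComputablePred fun c : ℕ => c = c₀ ∨ ∃ n, formulaCode e (neNumeral L m n) = c := by
  let step : ℕ → ℕ := fun x =>
    Nat.pair 2 (Nat.pair (e (Sum.inl ⟨1, succFunc L⟩)) (Nat.pair x 0 + 1))
  let t : ℕ → ℕ := fun n => step^[n] (termCode e (numeral L (Fin (m + 1) ⊕ Fin 0) 0))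
  let g : ℕ → ℕ := fun n =>
    Nat.pair 3 (Nat.pair (Nat.pair 1 (Nat.pair (t n) (Nat.pair 0 0))) (Nat.pair 0 0))
  have hg : ∀ n, formulaCode e (neNumeral L m n) = g n := fun n => by
    simp only [neNumeral, formulaCode, g, t, step]
    rw [termCode_numeral]
    rfl
  have hstep : Primrec step :=
    Primrec₂.natPair.comp (.const 2) (Primrec₂.natPair.comp (.const _)
      (Primrec.succ.comp (Primrec₂.natPair.comp .id (.const 0))))
  have ht : Primrec t := Primrec.nat_iterate .id (.const _) (hstep.comp .snd)
  have hgp : Primrec g :=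
    Primrec₂.natPair.comp (.const 3) (Primrec₂.natPair.comp (Primrec₂.natPair.comp (.const 1)
      (Primrec₂.natPair.comp ht (.const _))) (.const _))
  have hlt : ∀ x, x < step x := fun x =>
    calc x ≤ Nat.pair x 0 := Nat.left_le_pair _ _
      _ < Nat.pair x 0 + 1 := Nat.lt_succ_self _
      _ ≤ _ := Nat.right_le_pair _ _
      _ ≤ _ := Nat.right_le_pair _ _
  have hnt : ∀ n, n ≤ t n := fun n => by
    induction n with
    | zero => exact Nat.zero_le _
    | succ n ih =>
      simp only [t, Function.iterate_succ_apply'] at ih ⊢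
      exact Nat.succ_le_of_lt (ih.trans_lt (hlt _))
  have hng : ∀ n, n ≤ g n := fun n =>
    calc n ≤ t n := hnt n
      _ ≤ _ := Nat.left_le_pair _ _
      _ ≤ _ := Nat.right_le_pair _ _
      _ ≤ _ := Nat.left_le_pair _ _
      _ ≤ _ := Nat.right_le_pair _ _
  have hR : PrimrecRel fun x y : ℕ => g x = y := Primrec.eq.comp (hgp.comp .fst) .snd
  have hp : PrimrecPred fun c : ℕ => c = c₀ ∨ ∃ x < c + 1, g x = c :=
    (Primrec.eq.comp .id (.const c₀)).or (hR.exists_lt.comp Primrec.succ .id)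
  obtain ⟨_, hp⟩ := hp.of_eq (q := fun c : ℕ => c = c₀ ∨ ∃ n, formulaCode e (neNumeral L m n) = c)
    fun c => by
      simp only [hg]
      refine or_congr_right ⟨fun ⟨x, _, hx⟩ => ⟨x, hx⟩, fun ⟨x, hx⟩ => ⟨x, ?_, hx⟩⟩
      exact Nat.lt_succ_of_le (hx ▸ hng x)
  exact ⟨_, hp.to_comp⟩

/-- Overspill: a definable set that contains every standard element contains a nonstandard one. -/
theorem exists_nonstandard (hM : IsModelPA M)
    (hsat : IsPiecewiseRecursivelySaturated (LPA.sum L) M) {V : M → Prop}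
    (hV : ParamDef (LPA.sum L) (fun v : Fin 1 → M => V (v 0)))
    (hstd : ∀ n : ℕ, V (succ^[n] zero)) : ∃ x, V x ∧ ¬ IsStandard x := by
  obtain ⟨m, φ, a, hφ⟩ := hV.exists_formula_one
  -- The type says that `v` satisfies `φ` and differs from every numeral; its only symbols are those
  -- of `φ`, `0` and `S`.
  let p : Set ((LPA.sum L).Formula (Fin (m + 1))) := insert φ (Set.range (neNumeral L m))
  have hfin : (⋃ ψ ∈ p, formulaSymbols ψ).Finite := by
    refine ((formulaSymbols_finite φ).union (Set.toFinite
      {Sum.inl ⟨0, zeroFunc L⟩, Sum.inl ⟨1, succFunc L⟩})).subset (Set.iUnion₂_subset ?_)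
    rintro ψ (rfl | ⟨n, rfl⟩)
    · exact Set.subset_union_left
    · refine Set.Subset.trans ?_ Set.subset_union_right
      simp only [neNumeral, formulaSymbols, termSymbols, Set.union_empty]
      exact termSymbols_numeral _ n
  have hrec : IsFiniteSymbolRecursive p := by
    obtain ⟨e, he⟩ := Set.countable_iff_exists_injOn.1 hfin.countable
    refine ⟨hfin, e, he, ?_⟩
    convert computablePred_code_neNumeral e m (formulaCode e φ) using 2 with c
    simp [p, eq_comm]
  obtain ⟨x, hx⟩ := hsat m p a hrec fun F hF => by
    have hinj : Function.Injective (neNumeral L m) := fun n k h => by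
      by_contra hne
      have h1 := realize_neNumeral (L := L) m k (fun _ => (succ^[n] zero : M))
      rw [← h, realize_neNumeral] at h1
      exact h1.2 (fun h => hne (hM.standard_injective h).symm) rfl
    -- A standard number whose exclusion is not among the finitely many formulas realises all of
    -- them.
    obtain ⟨N, hN⟩ : ∃ N, neNumeral L m N ∉ F := by
      by_contra! h
      exact Set.infinite_range_of_injective hinj
        (F.finite_toSet.subset (Set.range_subset_iff.2 h))
    refine ⟨succ^[N] zero, fun ψ hψ => ?_⟩
    rcases hF hψ with rfl | ⟨n, rfl⟩
    · exact (hφ _).2 (hstd N)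
    · rw [realize_neNumeral]
      exact fun h => hN (hM.standard_injective h ▸ hψ)
  refine ⟨x, (hφ x).1 (hx φ (Set.mem_insert _ _)), fun ⟨n, hn⟩ => ?_⟩
  exact (realize_neNumeral m n _).1 (hx _ (Set.mem_insert_of_mem _ ⟨n, rfl⟩)) hn

/-- Collection for definable relations. -/
theorem SatisfiesCollection.exists_bound (hcoll : SatisfiesCollection (LPA.sum L) M)
    {R : M → M → Prop} (hR : ParamDef (LPA.sum L) (fun v : Fin 2 → M => R (v 0) (v 1))) {a : M}
    (h : ∀ x, Lt x a → ∃ y, R x y) : ∃ b, ∀ x, Lt x a → ∃ y, Lt y b ∧ R x y := by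
  obtain ⟨m, φ, p, hφ⟩ := hR.exists_formula_two
  simpa only [hφ] using hcoll m φ p a (by simpa only [hφ] using h)

end Saturation

/-! ### Forcing conditions and density lemmas. -/

section Forcing

open FirstOrder Language

variable (L : FirstOrder.Language.{u, v}) (M : Type w) [LPA.Structure M] [L.Structure M]

/-- A forcing condition: a definable decreasing family, indexed by `u ∈ M`, of nonempty sets of
assignments. A generic filter of conditions determines an extension of `M` whose elements are
named by the variables. -/
structure Condition where
  /-- The assignment `s` belongs to the `u`-th set of the family. -/
  rel : M → (ℕ → M) → Prop
  definable : ParamDef (LPA.sum L) fun v : ℕ → M => rel (v 0) fun i => v (i + 1)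
  antitone : ∀ {u u' s}, Le u u' → rel u' s → rel u s
  nonempty : ∀ u, ∃ s, rel u s

variable {L M}

namespace Condition

/-- Stronger conditions are larger. -/
instance : Preorder (Condition L M) where
  le D D' := ∀ u s, D'.rel u s → D.rel u s
  le_refl _ _ _ := id
  le_trans _ _ _ h h' u s hs := h u s (h' u s hs)

theorem paramDef_rel (D : Condition L M) {α : Type*} {f : (α → M) → M} {g : ℕ → (α → M) → M}
    (hf : ParamTerm (LPA.sum L) f) (hg : ∀ i, ParamTerm (LPA.sum L) (g i)) :
    ParamDef (LPA.sum L) fun v => D.rel (f v) fun i => g i v :=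
  D.definable.subst (f := fun n => Nat.casesOn n f g) fun n => by cases n; exacts [hf, hg _]

/-- Every total definable relation between assignments and elements of `M` can be uniformised by
a fresh variable. -/
theorem exists_witness (D : Condition L M) {R : (ℕ → M) → M → Prop}
    (hR : ParamDef (LPA.sum L) fun v : ℕ → M => R (fun i => v (i + 1)) (v 0))
    (htot : ∀ s, ∃ y, R s y) :
    ∃ D' : Condition L M, D ≤ D' ∧ ∃ j, ∀ u s, D'.rel u s → R s (s j) := by
  obtain ⟨n, hn⟩ := D.definable.exists_support
  obtain ⟨k, hk⟩ := hR.exists_support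
  have hagree : ∀ {i m : ℕ} (s : ℕ → M) (y z : M), i < m → m ≤ max n k →
      (Nat.casesOn i z (Function.update s (max n k) y) : M) = Nat.casesOn i z s := by
    intro i m s y z hi hm
    cases i with
    | zero => rfl
    | succ i => exact Function.update_of_ne (by omega) _ _
  -- The variable `j` lies beyond the supports of both `D` and `R`, so it can be reset freely.
  -- Indices are shifted by one, since slot `0` holds `u` or `y`.
  let j := max n k
  have hDj : ∀ u s y, D.rel u s → D.rel u (Function.update s j y) := fun u s y =>
    (hn (fun i => Nat.casesOn i u (Function.update s j y)) (fun i => Nat.casesOn i u s)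
      fun i hi => hagree s y u hi (le_max_left _ _)).2
  have hRj : ∀ s y, R s y → R (Function.update s j y) y := fun s y =>
    (hk (fun i => Nat.casesOn i y (Function.update s j y)) (fun i => Nat.casesOn i y s)
      fun i hi => hagree s y y hi (le_max_right _ _)).2
  refine ⟨⟨fun u s => D.rel u s ∧ R s (s j), ?_, fun h hs => ⟨D.antitone h hs.1, hs.2⟩,
    fun u => ?_⟩, fun u s hs => hs.1, j, fun u s hs => hs.2⟩
  · exact D.definable.and (hR.subst (f := fun n v => Nat.casesOn n (v (j + 1)) fun i => v (i + 1))
      fun n => by cases n <;> exact .var _)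
  · obtain ⟨s, hs⟩ := D.nonempty u
    obtain ⟨y, hy⟩ := htot s
    refine ⟨Function.update s j y, hDj u s y hs, ?_⟩
    rw [Function.update_self]
    exact hRj s y hy

theorem paramDef_realize {α : Type*} {n : ℕ} (φ : (LPA.sum L).BoundedFormula Empty (n + 1))
    (x : Fin n → α) (a : α) :
    ParamDef (LPA.sum L) fun v : α → M =>
      φ.Realize default (Fin.snoc (fun i => v (x i)) (v a) : Fin (n + 1) → M) := by
  refine ⟨φ.toFormula.relabel (Sum.elim Empty.elim fun i =>
    Sum.inl ((Fin.snoc x a : Fin (n + 1) → α) i)), fun v => ?_⟩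
  rw [Formula.realize_relabel, BoundedFormula.realize_toFormula]
  refine iff_of_eq (congrArg₂ φ.Realize (Subsingleton.elim _ _) (funext fun i => ?_))
  cases i using Fin.lastCases <;> simp

/-- The Henkin step: the implication from the existential to its instance is total in the witness,
so a fresh variable can realise it. -/
theorem exists_formula_witness (D : Condition L M) {n : ℕ}
    (φ : (LPA.sum L).BoundedFormula Empty (n + 1)) (x : Fin n → ℕ) :
    ∃ D' : Condition L M, D ≤ D' ∧ ∃ j, ∀ u s, D'.rel u s →
      (∃ y, φ.Realize default (Fin.snoc (fun i => s (x i)) y : Fin (n + 1) → M)) →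
        φ.Realize default (Fin.snoc (fun i => s (x i)) (s j) : Fin (n + 1) → M) := by
  refine D.exists_witness (R := fun s z =>
    (∃ y, φ.Realize default (Fin.snoc (fun i => s (x i)) y : Fin (n + 1) → M)) →
      φ.Realize default (Fin.snoc (fun i => s (x i)) z : Fin (n + 1) → M)) ?_ fun s => ?_
  · exact .imp (.ex (paramDef_realize (α := ℕ ⊕ Unit) φ (fun i => .inl (x i + 1)) (.inr ())))
      (paramDef_realize φ (fun i => x i + 1) 0)
  · by_cases h : ∃ y, φ.Realize default (Fin.snoc (fun i => s (x i)) y : Fin (n + 1) → M)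
    · exact ⟨h.choose, fun _ => h.choose_spec⟩
    · exact ⟨zero, fun h' => absurd h' h⟩

theorem exists_const (D : Condition L M) (m : M) :
    ∃ D' : Condition L M, D ≤ D' ∧ ∃ j, ∀ u s, D'.rel u s → s j = m :=
  D.exists_witness (R := fun _ y => y = m) (.eq (.var 0) (.const m)) fun _ => ⟨m, rfl⟩

/-- Collection makes the generic extension an end-extension. -/
theorem exists_decide_lt (hM : IsModelPA M) (hcoll : SatisfiesCollection (LPA.sum L) M)
    (D : Condition L M) (j : ℕ) (a : M) :
    ∃ D' : Condition L M, D ≤ D' ∧ ((∃ u, ∀ s, D'.rel u s → Lt a (s j)) ∨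
      ∃ m, Le m a ∧ ∀ u s, D'.rel u s → s j = m) := by
  -- If some `m ≤ a` is a possible value of `s j` at every index, fix that value. Otherwise each `m
  -- ≤ a` is excluded from some index on, and collection makes one index exclude them all.
  by_cases h : ∃ m, Le m a ∧ ∀ u, ∃ s, D.rel u s ∧ s j = m
  · obtain ⟨m, hm, h⟩ := h
    exact ⟨⟨fun u s => D.rel u s ∧ s j = m, D.definable.and (.eq (.var (j + 1)) (.const m)),
      fun h hs => ⟨D.antitone h hs.1, hs.2⟩, h⟩, fun u s hs => hs.1,
      .inr ⟨m, hm, fun u s hs => hs.2⟩⟩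
  · push Not at h
    refine ⟨D, le_rfl, .inl ?_⟩
    obtain ⟨b, hb⟩ := hcoll.exists_bound (R := fun m u => ¬ ∃ s, D.rel u s ∧ s j = m)
      (.not (.exs (.and (D.paramDef_rel (.var _) fun i => .var _) (.eq (.var _) (.var _)))))
      (a := succ a) fun m hm => by
        obtain ⟨u, hu⟩ := h m (hM.lt_succ_iff.1 hm)
        exact ⟨u, fun ⟨s, hs, hs'⟩ => hu s hs hs'⟩
    refine ⟨b, fun s hs => ?_⟩
    rcases hM.le_or_lt (s j) a with hle | hlt
    · obtain ⟨u, hub, hu⟩ := hb (s j) (hM.lt_succ_iff.2 hle)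
      exact absurd ⟨s, D.antitone (IsModelPA.le_of_lt hub) hs, rfl⟩ hu
    · exact hlt

/-- Treats the arguments `l < n` one at a time by external induction. The family `E` need not be
recorded as definable: only the bound `b` matters later, and the property of `b` is re-expressed
through `D`. -/
theorem exists_standard_bound (hM : IsModelPA M) (D : Condition L M) (i k n : ℕ) :
    ∃ b, ∃ E : M → (ℕ → M) → Prop, (∀ u s, E u s → D.rel u s) ∧
      (∀ u u' s, Le u u' → E u' s → E u s) ∧ (∀ u, ∃ s, E u s) ∧
      ∀ u s, E u s → ∀ l < n, ∀ y, Beta (s i) (s k) (succ^[l] zero) y → Le y b ∨ Lt u y := by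
  induction n with
  | zero =>
    exact ⟨zero, D.rel, fun _ _ => id, fun _ _ _ => D.antitone, D.nonempty,
      fun _ _ _ l hl => absurd hl (Nat.not_lt_zero l)⟩
  | succ n ih =>
    obtain ⟨b, E, hED, hanti, hne, hE⟩ := ih
    -- Either one bound `b'` for the value at `n` is compatible with every index, and the family is
    -- restricted to it; or every bound is eventually exceeded, and the family is restricted to
    -- assignments whose value exceeds the index.
    by_cases h : ∃ b', ∀ u, ∃ s, E u s ∧ ∀ y, Beta (s i) (s k) (succ^[n] zero) y → Le y b'
    · obtain ⟨b', hb'⟩ := h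
      obtain ⟨c, hbc, hbc'⟩ := hM.exists_ge b b'
      refine ⟨c, fun u s => E u s ∧ ∀ y, Beta (s i) (s k) (succ^[n] zero) y → Le y b',
        fun u s hs => hED u s hs.1, fun u u' s hu hs => ⟨hanti u u' s hu hs.1, hs.2⟩, hb',
        fun u s hs l hl y hy => ?_⟩
      rcases Nat.lt_succ_iff_lt_or_eq.1 hl with hl | rfl
      · exact (hE u s hs.1 l hl y hy).imp_left fun h => hM.le_trans h hbc
      · exact .inl (hM.le_trans (hs.2 y hy) hbc')
    · push Not at h
      refine ⟨b, fun u s => E u s ∧ ∀ y, Beta (s i) (s k) (succ^[n] zero) y → Lt u y,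
        fun u s hs => hED u s hs.1, fun u u' s hu hs => ⟨hanti u u' s hu hs.1,
          fun y hy => hM.lt_of_le_of_lt hu (hs.2 y hy)⟩, fun u => ?_, fun u s hs l hl y hy => ?_⟩
      -- From index `u₀` on the value exceeds `u`; an assignment at an index above both `u` and `u₀`
      -- also belongs to the family at `u`.
      · obtain ⟨u₀, hu₀⟩ := h u
        obtain ⟨c, huc, huc'⟩ := hM.exists_ge u u₀
        obtain ⟨s, hs⟩ := hne c
        obtain ⟨y, hy, hyu⟩ := hu₀ s (hanti _ _ _ huc' hs)
        refine ⟨s, hanti _ _ _ huc hs, fun y' hy' => ?_⟩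
        rw [hM.beta_unique hy' hy]
        exact (hM.le_or_lt y u).resolve_left hyu
      · rcases Nat.lt_succ_iff_lt_or_eq.1 hl with hl | rfl
        · exact hE u s hs.1 l hl y hy
        · exact .inr (hs.2 y hy)

/-- Saturation makes `M` locally semiregular in the generic extension. -/
theorem exists_bound (hM : IsModelPA M) (hsat : IsPiecewiseRecursivelySaturated (LPA.sum L) M)
    (D : Condition L M) (i k : ℕ) {a : M} (ha : ¬ IsStandard a) :
    ∃ D' : Condition L M, D ≤ D' ∧ ∃ a', Le a' a ∧ ¬ IsStandard a' ∧ ∃ b, ∀ u s, D'.rel u s →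
      ∀ x, Le x a' → ∀ y, Beta (s i) (s k) x y → Le y b ∨ Lt u y := by
  -- The overspilled property quantifies over assignments in `D` itself, so it is definable
  -- uniformly in `a'`.
  obtain ⟨a', ⟨hle, b, hb⟩, ha'⟩ := exists_nonstandard hM hsat
    (V := fun a' => Le a' a ∧ ∃ b, ∀ u, ∃ s, D.rel u s ∧
      ∀ x y, Le x a' → Beta (s i) (s k) x y → Le y b ∨ Lt u y)
    (.and (.le (.var 0) (.const a)) (.ex (.all (.exs (.and
      (D.paramDef_rel (.var _) fun i => .var _) (.all (.all (.imp (.le (.var _) (.var _)) (.imp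
        (.beta (.var _) (.var _) (.var _) (.var _))
        (.or (.le (.var _) (.var _)) (.lt (.var _) (.var _))))))))))))
    fun n => by
      refine ⟨hM.standard_le ha n, ?_⟩
      obtain ⟨b, E, hED, -, hne, hE⟩ := D.exists_standard_bound hM i k (n + 1)
      refine ⟨b, fun u => ?_⟩
      obtain ⟨s, hs⟩ := hne u
      refine ⟨s, hED u s hs, fun x y hx hy => ?_⟩
      obtain ⟨l, hl, rfl⟩ := hM.exists_standard_of_le n hx
      exact hE u s hs l (Nat.lt_succ_of_le hl) y hy
  -- Nonemptiness of the restricted condition is exactly the overspilled statement `hb`.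
  refine ⟨⟨fun u s => D.rel u s ∧ ∀ x y, Le x a' → Beta (s i) (s k) x y → Le y b ∨ Lt u y,
    ?_, fun h hs => ⟨D.antitone h hs.1, fun x y hx hy => ?_⟩, hb⟩, fun u s hs => hs.1, a', hle,
    ha', b, fun u s hs x hx y hy => hs.2 x y hx hy⟩
  · exact D.definable.and (.all (.all (.imp (.le (.var _) (.const a')) (.imp
        (.beta (.var _) (.var _) (.var _) (.var _))
        (.or (.le (.var _) (.const b)) (.lt (.var _) (.var _)))))))
  · exact (hs.2 x y hx hy).imp_right fun h' => hM.lt_of_le_of_lt h h'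

/-- The condition making variable `0` larger than every element of `M`. -/
def unbounded (hM : IsModelPA M) : Condition L M where
  rel u s := Lt u (s 0)
  definable := .lt (.var 0) (.var 1)
  antitone h hs := hM.lt_of_le_of_lt h hs
  nonempty u := ⟨fun _ => succ u, hM.lt_succ_iff.2 (hM.le_refl u)⟩

end Condition

end Forcing

/-! ### The generic ultrafilter and the structure it names. -/

section GenericExtension

open FirstOrder Language Filter

variable {L : FirstOrder.Language.{u, v}} {M : Type w} [LPA.Structure M] [L.Structure M]

instance countable_symbols_sum [Countable L.Symbols] : Countable (LPA.sum L).Symbols := by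
  have hF : ∀ n, Countable (L.Functions n) := fun n =>
    Function.Injective.countable (f := fun f => (Sum.inl ⟨n, f⟩ : L.Symbols)) fun f g h => by
      simpa using h
  have hR : ∀ n, Countable (L.Relations n) := fun n =>
    Function.Injective.countable (f := fun f => (Sum.inr ⟨n, f⟩ : L.Symbols)) fun f g h => by
      simpa using h
  have hF' : ∀ n, Countable ((LPA.sum L).Functions n) := fun n => by
    have : Countable (LPAFunc n) :=
      Function.Injective.countable (β := ℕ) (f := fun f => match f with
        | .zero => 0
        | .succ => 1
        | .add => 2
        | .mul => 3) fun f g h => by cases f <;> cases g <;> simp_all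
    exact inferInstanceAs (Countable (LPAFunc n ⊕ L.Functions n))
  have hR' : ∀ n, Countable ((LPA.sum L).Relations n) := fun n =>
    inferInstanceAs (Countable (Empty ⊕ L.Relations n))
  exact inferInstanceAs
    (Countable ((Σ n, (LPA.sum L).Functions n) ⊕ (Σ n, (LPA.sum L).Relations n)))

/-- Generic filters meeting countably many dense sets exist. -/
theorem exists_generic {P ι : Type*} [Preorder P] [Countable ι] (p : P) (S : ι → Set P)
    (hS : ∀ i p, ∃ q ∈ S i, p ≤ q) :
    ∃ G : Order.Ideal P, p ∈ G ∧ ∀ i, ∃ q ∈ G, q ∈ S i := by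
  have := Encodable.ofCountable ι
  let 𝒟 : ι → Order.Cofinal P := fun i => ⟨S i, fun p => hS i p⟩
  refine ⟨Order.idealOfCofinals p 𝒟, Order.mem_idealOfCofinals p 𝒟, fun i => ?_⟩
  obtain ⟨q, hq, hq'⟩ := Order.cofinal_meets_idealOfCofinals p 𝒟 i
  exact ⟨q, hq', hq⟩

/-- The sets `D_u` for `D ∈ G` are directed, as `G` is directed and each family decreases in `u`;
being nonempty, they generate a proper filter. -/
theorem exists_ultrafilter (hM : IsModelPA M) (G : Order.Ideal (Condition L M)) :
    ∃ U : Ultrafilter (ℕ → M), ∀ D ∈ G, ∀ u, ∀ᶠ s in (U : Filter (ℕ → M)), D.rel u s := by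
  let F : Filter (ℕ → M) := ⨅ q : {D // D ∈ G} × M, 𝓟 {s | q.1.1.rel q.2 s}
  have : Nonempty {D // D ∈ G} := G.nonempty.to_subtype
  have hF : F.NeBot := by
    refine iInf_neBot_of_directed' ?_ fun q => principal_neBot_iff.2 (q.1.1.nonempty q.2)
    rintro ⟨⟨D, hD⟩, u⟩ ⟨⟨D', hD'⟩, u'⟩
    obtain ⟨E, hE, hDE, hDE'⟩ := G.directed D hD D' hD'
    obtain ⟨c, hc, hc'⟩ := hM.exists_ge u u'
    exact ⟨⟨⟨E, hE⟩, c⟩, principal_mono.2 fun s hs => hDE _ _ (E.antitone hc hs),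
      principal_mono.2 fun s hs => hDE' _ _ (E.antitone hc' hs)⟩
  refine ⟨Ultrafilter.of F, fun D hD u => Ultrafilter.of_le F ?_⟩
  exact mem_iInf_of_mem (⟨⟨D, hD⟩, u⟩ : {D // D ∈ G} × M) (mem_principal_self _)

variable (L) in
/-- The properties of a generic ultrafilter on assignments from which the extension is built. -/
structure IsGeneric (U : Ultrafilter (ℕ → M)) : Prop where
  unbounded : ∀ m, ∀ᶠ s in (U : Filter (ℕ → M)), Lt m (s 0)
  witness : ∀ (n : ℕ) (φ : (LPA.sum L).BoundedFormula Empty (n + 1)) (x : Fin n → ℕ),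
    ∃ j, ∀ᶠ s in (U : Filter (ℕ → M)),
      (∃ y, φ.Realize default (Fin.snoc (fun i => s (x i)) y : Fin (n + 1) → M)) →
        φ.Realize default (Fin.snoc (fun i => s (x i)) (s j) : Fin (n + 1) → M)
  const : ∀ m, ∃ j, ∀ᶠ s in (U : Filter (ℕ → M)), s j = m
  decide_lt : ∀ j a, (∀ᶠ s in (U : Filter (ℕ → M)), Lt a (s j)) ∨
    ∃ m, Le m a ∧ ∀ᶠ s in (U : Filter (ℕ → M)), s j = m
  bound : ∀ (i k : ℕ) (a : M), ¬ IsStandard a → ∃ a', Le a' a ∧ ¬ IsStandard a' ∧ ∃ b, ∀ u,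
    ∀ᶠ s in (U : Filter (ℕ → M)), ∀ x, Le x a' → ∀ y, Beta (s i) (s k) x y → Le y b ∨ Lt u y

variable (L) in
theorem exists_isGeneric [Countable L.Symbols] [Countable M] (hM : IsModelPA M)
    (hcoll : SatisfiesCollection (LPA.sum L) M)
    (hsat : IsPiecewiseRecursivelySaturated (LPA.sum L) M) :
    ∃ U : Ultrafilter (ℕ → M), IsGeneric L U := by
  have hcount : ∀ n, Countable ((LPA.sum L).BoundedFormula Empty n) := fun n =>
    Function.Injective.countable
      (f := fun φ => (⟨n, φ⟩ : Σ n, (LPA.sum L).BoundedFormula Empty n)) fun φ ψ h => by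
        simpa using h
  -- The dense sets to be met: Skolem witnesses, names for elements of `M`, comparisons with
  -- elements of `M`, and bounds for coded functions.
  let W : (Σ n : ℕ, (LPA.sum L).BoundedFormula Empty (n + 1) × (Fin n → ℕ)) →
      Set (Condition L M) := fun q => {D | ∃ j, ∀ u s, D.rel u s →
        (∃ y, q.2.1.Realize default (Fin.snoc (fun i => s (q.2.2 i)) y : Fin (q.1 + 1) → M)) →
          q.2.1.Realize default (Fin.snoc (fun i => s (q.2.2 i)) (s j) : Fin (q.1 + 1) → M)}
  let C : M → Set (Condition L M) := fun m => {D | ∃ j, ∀ u s, D.rel u s → s j = m}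
  let E : ℕ × M → Set (Condition L M) := fun q =>
    {D | (∃ u, ∀ s, D.rel u s → Lt q.2 (s q.1)) ∨
      ∃ m, Le m q.2 ∧ ∀ u s, D.rel u s → s q.1 = m}
  let B : ℕ × ℕ × {a : M // ¬ IsStandard a} → Set (Condition L M) := fun q =>
    {D | ∃ a', Le a' q.2.2.1 ∧ ¬ IsStandard a' ∧ ∃ b, ∀ u s, D.rel u s →
      ∀ x, Le x a' → ∀ y, Beta (s q.1) (s q.2.1) x y → Le y b ∨ Lt u y}
  obtain ⟨G, hG₀, hG⟩ := exists_generic (Condition.unbounded hM : Condition L M)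
    (Sum.elim W (Sum.elim C (Sum.elim E B))) (by
      rintro (q | m | q | q) D
      · obtain ⟨D', h, h'⟩ := D.exists_formula_witness q.2.1 q.2.2
        exact ⟨D', h', h⟩
      · obtain ⟨D', h, h'⟩ := D.exists_const m
        exact ⟨D', h', h⟩
      · obtain ⟨D', h, h'⟩ := D.exists_decide_lt hM hcoll q.1 q.2
        exact ⟨D', h', h⟩
      · obtain ⟨D', h, h'⟩ := D.exists_bound hM hsat q.1 q.2.1 q.2.2.2
        exact ⟨D', h', h⟩)
  obtain ⟨U, hU⟩ := exists_ultrafilter hM G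
  refine ⟨U, fun m => hU _ hG₀ m, fun n φ x => ?_, fun m => ?_, fun j a => ?_, fun i k a ha => ?_⟩
  · obtain ⟨D, hD, j, hj⟩ := hG (.inl ⟨n, φ, x⟩)
    exact ⟨j, (hU D hD zero).mono fun s hs => hj _ s hs⟩
  · obtain ⟨D, hD, j, hj⟩ := hG (.inr (.inl m))
    exact ⟨j, (hU D hD zero).mono fun s hs => hj _ s hs⟩
  · obtain ⟨D, hD, ⟨u, h⟩ | ⟨m, hm, h⟩⟩ := hG (.inr (.inr (.inl (j, a))))
    · exact .inl ((hU D hD u).mono h)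
    · exact .inr ⟨m, hm, (hU D hD zero).mono fun s hs => h _ s hs⟩
  · obtain ⟨D, hD, a', hle, hns, b, hb⟩ := hG (.inr (.inr (.inr (i, k, ⟨a, ha⟩))))
    exact ⟨a', hle, hns, b, fun u => (hU D hD u).mono fun s hs => hb u s hs⟩

/-- The structure whose elements are named by variables and whose theory is decided by `U`. -/
theorem exists_named_structure {K : FirstOrder.Language.{u, v}} {M : Type w} [K.Structure M]
    [Nonempty M] (U : Ultrafilter (ℕ → M))
    (hU : ∀ (n : ℕ) (φ : K.BoundedFormula Empty (n + 1)) (x : Fin n → ℕ),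
      ∃ j, ∀ᶠ s in (U : Filter (ℕ → M)),
        (∃ y, φ.Realize default (Fin.snoc (fun i => s (x i)) y : Fin (n + 1) → M)) →
          φ.Realize default (Fin.snoc (fun i => s (x i)) (s j) : Fin (n + 1) → M)) :
    ∃ (N : Type w) (_ : K.Structure N) (ev : ℕ → N), Function.Surjective ev ∧
      ∀ {α : Type} (φ : K.Formula α) (x : α → ℕ),
        φ.Realize (fun i => ev (x i)) ↔
          ∀ᶠ s in (U : Filter (ℕ → M)), φ.Realize fun i => s (x i) := by
  let Q := (U : Filter (ℕ → M)).Product fun _ => M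
  -- Variables name coordinate functions. Their range is an elementary substructure of the
  -- ultrapower by Tarski–Vaught, with `hU` supplying witnesses among the variables.
  let ev : ℕ → Q := fun j => ((fun s => s j : (ℕ → M) → M) : Q)
  have snoc_eq : ∀ {n : ℕ} {X : Type w} (f : ℕ → X) (x : Fin n → ℕ) (j : ℕ),
      (fun i => f ((Fin.snoc x j : Fin (n + 1) → ℕ) i)) = Fin.snoc (fun i => f (x i)) (f j) := by
    intro n X f x j
    funext i
    cases i using Fin.lastCases <;> simp
  have los : ∀ {n : ℕ} (φ : K.BoundedFormula Empty n) (x : Fin n → ℕ),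
      φ.Realize (default : Empty → Q) (fun i => ev (x i)) ↔
        ∀ᶠ s in (U : Filter (ℕ → M)), φ.Realize default fun i => s (x i) := by
    intro n φ x
    have h := Ultraproduct.boundedFormula_realize_cast (M := fun _ : ℕ → M => M) (u := U) φ
      (fun i => i.elim) (fun i s => s (x i))
    refine Iff.trans (iff_of_eq (congrArg (φ.Realize · _) (Subsingleton.elim _ _))) (h.trans ?_)
    exact eventually_congr (.of_forall fun s =>
      iff_of_eq (congrArg (φ.Realize · _) (Subsingleton.elim _ _)))
  have meets : ∀ {n : ℕ} (φ : K.BoundedFormula Empty (n + 1)) (x : Fin n → ℕ) (a : Q),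
      φ.Realize (default : Empty → Q) (Fin.snoc (fun i => ev (x i)) a : Fin (n + 1) → Q) →
        ∃ j, φ.Realize (default : Empty → Q)
          (Fin.snoc (fun i => ev (x i)) (ev j) : Fin (n + 1) → Q) := by
    intro n φ x a h
    obtain ⟨j, hj⟩ := hU n φ x
    refine ⟨j, ?_⟩
    rw [← snoc_eq ev, los]
    have hex := (los φ.ex x).1 (BoundedFormula.realize_ex.2 ⟨a, h⟩)
    filter_upwards [hj, hex] with s hs hs'
    rw [snoc_eq s]
    exact hs (BoundedFormula.realize_ex.1 hs')
  let S : K.Substructure Q :=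
    { carrier := Set.range ev
      fun_mem := by
        intro n f a ha
        choose x hx using ha
        -- Closure under `f` is the witness property for the formula `f(x) = y`.
        let φ : K.BoundedFormula Empty (n + 1) :=
          .equal (.func f fun i => .var (.inr i.castSucc)) (.var (.inr (Fin.last n)))
        have hφ : ∀ q : Q, φ.Realize (default : Empty → Q)
            (Fin.snoc (fun i => ev (x i)) q : Fin (n + 1) → Q) ↔ Structure.funMap f a = q := by
          intro q
          rw [← show (fun i => ev (x i)) = a from funext hx]
          simp [φ, BoundedFormula.Realize]
        obtain ⟨j, hj⟩ := meets φ x (Structure.funMap f a) ((hφ _).2 rfl)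
        exact ⟨j, ((hφ _).1 hj).symm⟩ }
  have hS : S.IsElementary := by
    refine S.isElementary_of_exists fun n φ x a h => ?_
    choose y hy using fun i => (x i).2
    have hxy : (Subtype.val ∘ x : Fin n → Q) = fun i => ev (y i) := funext fun i => (hy i).symm
    rw [hxy] at h ⊢
    obtain ⟨j, hj⟩ := meets φ y a h
    exact ⟨⟨ev j, j, rfl⟩, hj⟩
  refine ⟨S, inferInstance, fun j => ⟨ev j, j, rfl⟩, fun ⟨_, j, hj⟩ => ⟨j, Subtype.ext hj⟩,
    fun φ x => ?_⟩
  rw [← (⟨S, hS⟩ : K.ElementarySubstructure Q).subtype.map_formula]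
  exact Ultraproduct.realize_formula_cast (M := fun _ : ℕ → M => M) φ fun i s => s (x i)

end GenericExtension

/-! ### Arithmetical formulas used for transfer. -/

section Transfer

open FirstOrder Language Filter

/-- The formula `x ≤ y`. -/
def leFormula : LPA.Formula (Fin 2) :=
  ((addTerm (.var (.inl 0)) (.var (.inr 0))).bdEqual (.var (.inl 1)) :
    LPA.BoundedFormula (Fin 2) 1).ex

/-- The formula `x < y`. -/
def ltFormula : LPA.Formula (Fin 2) :=
  ((addTerm (.var (.inl 0)) (succTerm (.var (.inr 0)))).bdEqual (.var (.inl 1)) :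
    LPA.BoundedFormula (Fin 2) 1).ex

/-- The formula stating that `y` is the value at `x` of the function with `β`-code `(c, d)`. -/
def betaFormula : LPA.Formula (Fin 4) :=
  ((addTerm (.var (.inl 3)) (succTerm (.var (.inr 0)))).bdEqual
      (succTerm (mulTerm (succTerm (.var (.inl 2))) (.var (.inl 1)))) :
    LPA.BoundedFormula (Fin 4) 1).ex ⊓
  ((Term.var (.inl 0)).bdEqual (addTerm (mulTerm (.var (.inr 0))
      (succTerm (mulTerm (succTerm (.var (.inl 2))) (.var (.inl 1))))) (.var (.inl 3))) :
    LPA.BoundedFormula (Fin 4) 1).ex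

variable {X : Type*} [LPA.Structure X]

theorem realize_leFormula (v : Fin 2 → X) : leFormula.Realize v ↔ Le (v 0) (v 1) := by
  simp [leFormula, Formula.Realize, Le, Fin.snoc]

theorem realize_ltFormula (v : Fin 2 → X) : ltFormula.Realize v ↔ Lt (v 0) (v 1) := by
  simp [ltFormula, Formula.Realize, Lt, Fin.snoc]

theorem realize_betaFormula (v : Fin 4 → X) :
    betaFormula.Realize v ↔ Beta (v 0) (v 1) (v 2) (v 3) := by
  simp [betaFormula, Formula.Realize, Beta, Lt, Fin.snoc]

end Transfer

/-! ### The extension and its properties. -/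

section Main

open FirstOrder Language Filter

variable {L : FirstOrder.Language.{u, v}} {M : Type w} [LPA.Structure M] [L.Structure M]

/-- Every structure for `LPA.sum L` comes from its two reducts. -/
theorem exists_eq_sumStructure (N : Type*) (S : (LPA.sum L).Structure N) :
    ∃ (_ : LPA.Structure N) (_ : L.Structure N), S = LPA.sumStructure L N := by
  refine ⟨(LHom.sumInl : LPA →ᴸ LPA.sum L).reduct N,
    (LHom.sumInr : L →ᴸ LPA.sum L).reduct N, ?_⟩
  ext n f x
  · cases f <;> rfl
  · cases f <;> rfl

/-- Each property of `N` is a statement about almost all assignments, by Łoś. Finitely many such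
statements hold at a common `s`, which brings the question back to `M`. -/
theorem IsGeneric.exists_extension {U : Ultrafilter (ℕ → M)} (hU : IsGeneric L U)
    (hM : IsModelPA M) (hns : ∃ a : M, ¬ IsStandard a) :
    ∃ (N : Type w) (_ : LPA.Structure N) (_ : L.Structure N) (j : M ↪ₑ[LPA.sum L] N),
      IsProperEndExtension j ∧ IsLocallySemiregular (Set.range j) := by
  obtain ⟨N, S, ev, hev, hreal⟩ := exists_named_structure (K := LPA.sum L) U hU.witness
  obtain ⟨S₁, S₂, rfl⟩ := exists_eq_sumStructure N S
  choose c hc using hU.const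
  have hreal' : ∀ {n : ℕ} (φ : LPA.Formula (Fin n)) (x : Fin n → ℕ),
      φ.Realize (fun i => ev (x i)) ↔
        ∀ᶠ s in (U : Filter (ℕ → M)), φ.Realize fun i => s (x i) := fun φ x => by
    simpa only [LHom.realize_onFormula] using
      hreal ((LHom.sumInl : LPA →ᴸ LPA.sum L).onFormula φ) x
  have hle : ∀ i k, Le (ev i) (ev k) ↔ ∀ᶠ s in (U : Filter (ℕ → M)), Le (s i) (s k) :=
    fun i k => by simpa [realize_leFormula] using hreal' leFormula ![i, k]
  have hlt : ∀ i k, Lt (ev i) (ev k) ↔ ∀ᶠ s in (U : Filter (ℕ → M)), Lt (s i) (s k) :=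
    fun i k => by simpa [realize_ltFormula] using hreal' ltFormula ![i, k]
  have hbeta : ∀ i k l m, Beta (ev i) (ev k) (ev l) (ev m) ↔
      ∀ᶠ s in (U : Filter (ℕ → M)), Beta (s i) (s k) (s l) (s m) :=
    fun i k l m => by simpa [realize_betaFormula] using hreal' betaFormula ![i, k, l, m]
  have heq : ∀ i k, ev i = ev k ↔ ∀ᶠ s in (U : Filter (ℕ → M)), s i = s k := fun i k => by
    simpa using hreal ((Term.var (0 : Fin 2)).equal (Term.var 1)) ![i, k]
  let j : M ↪ₑ[LPA.sum L] N :=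
    { toFun := fun m => ev (c m)
      map_formula' := fun n φ x => by
        refine (hreal φ fun i => c (x i)).trans ?_
        -- Only finitely many parameters occur, so almost every assignment gives all their names the
        -- right values.
        have hx : ∀ᶠ s in (U : Filter (ℕ → M)), ∀ i, s (c (x i)) = x i :=
          eventually_all.2 fun i => hc (x i)
        rw [← eventually_const (p := φ.Realize x) (f := (U : Filter (ℕ → M)))]
        refine eventually_congr (hx.mono fun s hs => ?_)
        rw [funext hs] }
  have hj : ∀ m, j m = ev (c m) := fun _ => rfl
  have hjle : ∀ {a b : M}, Le (j a) (j b) ↔ Le a b := fun {a b} => by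
    rw [hj, hj, hle, ← eventually_const (p := Le a b) (f := (U : Filter (ℕ → M)))]
    refine eventually_congr ?_
    filter_upwards [hc a, hc b] with s ha hb
    rw [ha, hb]
  have hdec : ∀ (i : ℕ) (a : M), Lt (j a) (ev i) ∨ ∃ m, Le m a ∧ j m = ev i := fun i a => by
    rcases hU.decide_lt i a with h | ⟨m, hm, h⟩
    · refine .inl ((hlt _ _).2 ?_)
      filter_upwards [h, hc a] with s hs ha
      rwa [ha]
    · refine .inr ⟨m, hm, (heq _ _).2 ?_⟩
      filter_upwards [h, hc m] with s hs ha
      rw [hs, ha]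
  have hnotlt : ∀ (i : ℕ) (a : M), Le (ev i) (j a) → ¬ Lt (j a) (ev i) := fun i a h h' => by
    obtain ⟨s, hs, hs'⟩ := (((hle _ _).1 h).and ((hlt _ _).1 h')).exists
    exact hM.lt_irrefl _ (hM.lt_of_le_of_lt hs hs')
  have hinit : ∀ (b : N) (a : M), Le b (j a) → ∃ m, Le m a ∧ j m = b := fun b a h => by
    obtain ⟨i, rfl⟩ := hev b
    exact (hdec i a).resolve_left (hnotlt i a h)
  have hjsucc : ∀ m, j (succ m) = succ (j m) := fun m => by
    refine (j.map_fun (succFunc L) ![m]).trans ?_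
    exact congrArg (Structure.funMap (L := LPA) LPAFunc.succ)
      (funext fun i => by fin_cases i; rfl)
  have hjzero : j zero = zero := by
    refine (j.map_fun (zeroFunc L) ![]).trans ?_
    exact congrArg (Structure.funMap (L := LPA) LPAFunc.zero) (Subsingleton.elim _ _)
  have hjstd : ∀ n : ℕ, j (succ^[n] zero) = succ^[n] zero := fun n => by
    induction n with
    | zero => exact hjzero
    | succ n ih => rw [Function.iterate_succ_apply', Function.iterate_succ_apply', hjsucc, ih]
  have hstd : ∀ {m : M}, IsStandard (j m) ↔ IsStandard m := fun {m} =>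
    ⟨fun ⟨n, hn⟩ => ⟨n, j.injective ((hjstd n).trans hn)⟩,
      fun ⟨n, hn⟩ => ⟨n, (hjstd n).symm.trans (congrArg j hn)⟩⟩
  refine ⟨N, S₁, S₂, j, ⟨fun h => ?_, fun b hb a => ?_⟩, ⟨?_, ?_⟩, ?_, ?_⟩
  -- Variable `0` is above every element of `M`, so its class is a new element.
  · obtain ⟨m, hm⟩ : ev 0 ∈ Set.range j := h ▸ Set.mem_univ _
    obtain ⟨s, hs, hs', hs''⟩ :=
      (((heq _ _).1 hm).and ((hc m).and (hU.unbounded m))).exists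
    rw [hs'] at hs
    rw [← hs] at hs''
    exact hM.lt_irrefl _ hs''
  · obtain ⟨i, rfl⟩ := hev b
    exact (hdec i a).resolve_right fun ⟨m, _, hm⟩ => hb ⟨m, hm⟩
  · rintro _ ⟨a, rfl⟩ b hb
    obtain ⟨m, -, hm⟩ := hinit b a hb
    exact ⟨m, hm⟩
  · rintro _ ⟨a, rfl⟩
    exact ⟨succ a, hjsucc a⟩
  · obtain ⟨a, ha⟩ := hns
    exact ⟨j a, ⟨a, rfl⟩, fun h => ha (hstd.1 h)⟩
  · rintro _ ⟨a, rfl⟩ ha f ⟨p, q, hf⟩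
    obtain ⟨i, rfl⟩ := hev p
    obtain ⟨k, rfl⟩ := hev q
    obtain ⟨a', hle', hns', b, hb⟩ := hU.bound i k a fun h => ha (hstd.2 h)
    refine ⟨j a', hjle.2 hle', fun h => hns' (hstd.1 h), j b, ⟨b, rfl⟩, ?_⟩
    rintro x hx ⟨y, hy⟩
    obtain ⟨x₀, hx₀, hxx₀⟩ := hinit x.1 a' hx
    have hB : Beta (ev i) (ev k) (j x₀) (j y) := by
      rw [hxx₀, hy]
      exact hf x
    rw [← hy, hjle]
    -- The bound is applied at the index `u = y`, the value itself, where the alternative `u < y` is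
    -- impossible.
    obtain ⟨s, hs, hsx, hsy, hsb⟩ :=
      (((hbeta _ _ _ _).1 hB).and ((hc x₀).and ((hc y).and (hb y)))).exists
    rw [hsx, hsy] at hs
    exact (hsb x₀ hx₀ y hs).resolve_right (hM.lt_irrefl y)

end Main

end Arith

/-- A signature extending the language of arithmetic is `LPA.sum L`, where `L` consists of the
additional symbols; a structure for it is a structure for `LPA` together with one for `L`. -/
theorem mainTheorem7 (L : FirstOrder.Language.{u, v}) [Countable L.Symbols]
    (M : Type w) [Countable M] [Arith.LPA.Structure M] [L.Structure M]
    (hPA : Arith.IsModelPA M)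
    (hcoll : Arith.SatisfiesCollection (Arith.LPA.sum L) M)
    (hsat : Arith.IsPiecewiseRecursivelySaturated (Arith.LPA.sum L) M) :
    ∃ (N : Type w) (_ : Arith.LPA.Structure N) (_ : L.Structure N)
      (j : M ↪ₑ[Arith.LPA.sum L] N),
      Arith.IsProperEndExtension j ∧ Arith.IsLocallySemiregular (Set.range j) := by
  obtain ⟨U, hU⟩ := Arith.exists_isGeneric L hPA hcoll hsat
  -- Overspill for the trivial property yields a nonstandard element of `M`.
  obtain ⟨a, -, ha⟩ := Arith.exists_nonstandard hPA hsat (V := fun _ => True)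
    ((Arith.ParamDef.eq (.var 0) (.var 0)).congr fun _ => by simp) fun _ => trivial
  exact hU.exists_extension hPA ⟨a, ha⟩
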